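/- Let $\mathcal L:\mathbb R^d\to\mathbb R$ be differentiable and bounded below, $\mathcal L\ge \mathcal L_{\inf}$. GONO with hyperparameters $\alpha>0$, $\beta_1\in[0,1)$, $\beta_2$, $\beta_{1,\min},\beta_{1,\max}$, $\lambda\ge 0$, $\varepsilon>0$ is the following scheme. Start from a (possibly random) $\theta_1\in\mathbb R^d$ with $m_0=v_0=g_0=0$, and for $t=1,2,\dots$ put $g_t=\nabla\mathcal L(\theta_t)$, $$\mathrm{cc}_t=\frac{\langle g_t,g_{t-1}\rangle}{\|g_t\|\,\|g_{t-1}\|+\varepsilon},\qquad \beta_{1,t}=\mathrm{clip}\bigl(\beta_1(1+\lambda\,\mathrm{cc}_t),\,\beta_{1,\min},\,\beta_{1,\max}\bigr),$$ $$m_t=\beta_{1,t}m_{t-1}+(1-\beta_{1,t})g_t,\qquad v_t=\beta_2v_{t-1}+(1-\beta_2)g_t^2,$$ $$\hat m_t=\frac{m_t}{1-\beta_1^t},\qquad \hat v_t=\frac{v_t}{1-\beta_2^t},\qquad \theta_{t+1}=\theta_t-\frac{\alpha}{\sqrt t}\,\frac{\hat m_t}{\sqrt{\hat v_t}+\varepsilon},$$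 where squares, square roots and quotients of vectors are taken coordinatewise and $\mathrm{clip}(x,a,b)=\max(a,\min(x,b))$. Adam is the same scheme with $\beta_{1,t}=\beta_1$ for all $t$. Theorem (GONO convergence rate). Assume that 1. $\|\nabla\mathcal L(\theta)-\nabla\mathcal L(\varphi)\|\le L\|\theta-\varphi\|$ for all $\theta,\varphi\in\mathbb R^d$; 2. almost surely, $\|\nabla\mathcal L(\theta_t)\|\le G$ for all $t\ge1$; 3. $0<\beta_{1,\min}\le\beta_{1,\max}<\sqrt{\beta_2}<1$ (so that $\beta_{1,t}\in[\beta_{1,\min},\beta_{1,\max}]$ for all $t$). Assume also $\beta_1\le\bar\beta_1$ for some $\bar\beta_1<1$, and that $\mathcal L(\theta_1)$ is integrable with $\mathbb E[\mathcal L(\theta_1)]-\mathcal L_{\inf}\le\Delta$. Then there is a constant $C$, depending only on $L,G,\alpha,\bar\beta_1,\beta_{1,\max},\beta_2,\varepsilon,\Delta$ (not on $T$, $d$, $\mathcal L$, the law of $\theta_1$, $\lambda$ or $\beta_{1,\min}$), such that the GONO iterates satisfy, for every $T\ge1$, $$\frac1T\sum_{t=1}^T\mathbb E\bigl[\|\nabla\mathcal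 L(\theta_t)\|^2\bigr]\le\frac{C}{\sqrt T},$$ all these expectations being finite. If $\beta_{1,\min}\le\beta_1\le\beta_{1,\max}$, then Adam, under the same assumptions (with 2. along its own iterates), satisfies the same bound with the same constant $C$. -/

import Mathlib

open MeasureTheory

noncomputable section

namespace GONO

/-- The parameter space `ℝ^d` with its Euclidean norm. -/
abbrev Param (d : ℕ) : Type := EuclideanSpace ℝ (Fin d)

/-- `clip x lo hi` truncates `x` to the interval `[lo, hi]` (for `lo ≤ hi`). -/
def clip (x lo hi : ℝ) : ℝ := max lo (min x hi)

/-- The consecutive cosine similarity of the current gradient `g` and the previous gradient `g'`,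
with numerical stabilizer `ε`. -/
def consecutiveCosine {d : ℕ} (ε : ℝ) (g g' : Param d) : ℝ :=
  inner ℝ g g' / (‖g‖ * ‖g'‖ + ε)

/-- The adaptive momentum coefficient of GONO as a function of the current and the previous
gradient. -/
def adaptiveMomentum {d : ℕ} (β₁ β₁min β₁max lam ε : ℝ) (g g' : Param d) : ℝ :=
  clip (β₁ * (1 + lam * consecutiveCosine ε g g')) β₁min β₁max

/-- What the optimizer stores: the parameters, the first and second moment estimates, and the
previous gradient. -/
structure State (d : ℕ) where
  /-- the parameters -/
  θ : Param d
  /-- the first moment estimate -/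
  m : Param d
  /-- the coordinatewise second moment estimate -/
  v : Fin d → ℝ
  /-- the previous gradient -/
  gPrev : Param d

/-- Step number `t ≥ 1` of the Adam scheme on the loss `loss`, with step size `α / √t`, where the
momentum coefficient of this step is `mom g g'`, for `g` the current and `g'` the previous gradient.
The bias correction of the first moment uses the base coefficient `β₁`. -/
def step {d : ℕ} (loss : Param d → ℝ) (mom : Param d → Param d → ℝ) (α β₁ β₂ ε : ℝ)
    (t : ℕ) (s : State d) : State d :=
  let g : Param d := gradient loss s.θ
  let b : ℝ := mom g s.gPrev
  let m : Param d := b • s.m + (1 - b) • g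
  let v : Fin d → ℝ := fun i => β₂ * s.v i + (1 - β₂) * (g i) ^ 2
  { θ := WithLp.toLp 2 fun i =>
      s.θ i - α / √(t : ℝ) * ((m i / (1 - β₁ ^ t)) / (√(v i / (1 - β₂ ^ t)) + ε))
    m := m
    v := v
    gPrev := g }

/-- The state after `n` steps from the initial parameters `θ₁`; both moment estimates and the
previous gradient are initialized to zero. -/
def stateAfter {d : ℕ} (loss : Param d → ℝ) (mom : Param d → Param d → ℝ) (α β₁ β₂ ε : ℝ)
    (θ₁ : Param d) : ℕ → State d
  | 0 => { θ := θ₁, m := 0, v := 0, gPrev := 0 }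
  | n + 1 => step loss mom α β₁ β₂ ε (n + 1) (stateAfter loss mom α β₁ β₂ ε θ₁ n)

/-- The GONO iterate `θ_t`, for `t ≥ 1`, started at `θ₁`. The iterate `θ_t` is what `t - 1` steps
produce, so that step `t` evaluates the gradient at `θ_t` and yields `θ_{t+1}`. -/
def gonoIterate {d : ℕ} (loss : Param d → ℝ) (α β₁ β₁min β₁max lam β₂ ε : ℝ) (θ₁ : Param d)
    (t : ℕ) : Param d :=
  (stateAfter loss (adaptiveMomentum β₁ β₁min β₁max lam ε) α β₁ β₂ ε θ₁ (t - 1)).θ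

/-- The Adam iterate `θ_t`, for `t ≥ 1`, started at `θ₁`: the same scheme with the constant momentum
coefficient `β₁`. -/
def adamIterate {d : ℕ} (loss : Param d → ℝ) (α β₁ β₂ ε : ℝ) (θ₁ : Param d) (t : ℕ) : Param d :=
  (stateAfter loss (fun _ _ => β₁) α β₁ β₂ ε θ₁ (t - 1)).θ

/-- `L`-smoothness: the function is differentiable and its gradient is `L`-Lipschitz. -/
def IsSmoothLoss {d : ℕ} (L : ℝ) (loss : Param d → ℝ) : Prop :=
  Differentiable ℝ loss ∧
    ∀ θ φ : Param d, ‖gradient loss θ - gradient loss φ‖ ≤ L * ‖θ - φ‖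

/-- Almost surely, all gradients along the random trajectory `θ_1, θ_2, …` are bounded by `G`. -/
def GradientsBounded {d : ℕ} {Ω : Type*} [MeasurableSpace Ω] (P : Measure Ω)
    (loss : Param d → ℝ) (θ : ℕ → Ω → Param d) (G : ℝ) : Prop :=
  ∀ᵐ ω ∂P, ∀ t : ℕ, 1 ≤ t → ‖gradient loss (θ t ω)‖ ≤ G

/-- The expected squared gradient norms along `θ_1, θ_2, …` exist, and for every horizon `T ≥ 1`
the average of the first `T` of them is at most `C / √T`. -/
def HasRate {d : ℕ} {Ω : Type*} [MeasurableSpace Ω] (P : Measure Ω)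
    (loss : Param d → ℝ) (θ : ℕ → Ω → Param d) (C : ℝ) : Prop :=
  (∀ t : ℕ, 1 ≤ t → Integrable (fun ω => ‖gradient loss (θ t ω)‖ ^ 2) P) ∧
    ∀ T : ℕ, 1 ≤ T →
      1 / (T : ℝ) * ∑ t ∈ Finset.Icc 1 T, ∫ ω, ‖gradient loss (θ t ω)‖ ^ 2 ∂P ≤ C / √(T : ℝ)

end GONO

end

noncomputable section

namespace GONO

/-! Momentum is handled by a Lyapunov function. With `w` the total weight that `m` gives to past
gradients, put `e = m - w • g`. Then `e` starts at zero, is contracted by a factor at most `B < 1`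
in each step, and is perturbed only by the change of the gradient, which smoothness makes O(η) for
step size η (`momentError_succ`). Bounded gradients confine the diagonal preconditioner to an
interval `[δ, K]` with `δ > 0` (`precond_mem`), so a step descends along `g` at rate at least `a =
(1 - B) * δ`, up to a cross term in `‖g‖ * ‖e‖`.

Adding a suitable multiple of `η * ‖e‖ ^ 2` to the loss absorbs this cross term
(`potential_step_scalar`, `potential_step`). What remains is `η * (M * η - a / 4) * (‖g‖ ^ 2 + ‖e‖ ^
2)`. It is nonpositive once η is small, so only a number of early steps independent of `T` costs
anything, and no logarithm of `T` appears. Telescoping bounds `∑ η * ‖g‖ ^ 2` pathwise; η is at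
least `α / √T` up to time `T`, and taking expectations gives the rate. The momentum rule enters only
through measurability and its range `[0, B]`, so GONO and Adam share one proof and one constant. -/

/-! ### Smoothness and diagonal scaling. -/

/-- The descent inequality for a function with Lipschitz gradient, in the form the mean value theorem
gives. -/
theorem IsSmoothLoss.le_add_inner {d : ℕ} {L : ℝ} {loss : Param d → ℝ}
    (h : IsSmoothLoss L loss) (hL : 0 ≤ L) (x y : Param d) :
    loss y ≤ loss x + inner ℝ (gradient loss x) (y - x) + L * ‖y - x‖ ^ 2 := by
  obtain ⟨z, hz, hzeq⟩ := domain_mvt (f := loss) (s := Set.univ) (x := x) (y := y)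
    (f' := fun z => fderiv ℝ loss z)
    (fun z _ => (h.1 z).hasFDerivAt.hasFDerivWithinAt) convex_univ trivial trivial
  have hgrad : fderiv ℝ loss z (y - x) = inner ℝ (gradient loss z) (y - x) := by
    rw [gradient, InnerProductSpace.toDual_symm_apply]
  -- The mean value point lies on the segment; bounding its distance by the full length costs a
  -- factor 2 against the sharp constant `L / 2`.
  have hzx : ‖z - x‖ ≤ ‖y - x‖ := by
    simpa [dist_eq_norm, norm_sub_rev] using
      (dist_add_dist_of_mem_segment hz ▸ le_add_of_nonneg_right dist_nonneg :
        dist x z ≤ dist x y)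
  have h1 : inner ℝ (gradient loss z - gradient loss x) (y - x) ≤ L * ‖y - x‖ ^ 2 :=
    calc inner ℝ (gradient loss z - gradient loss x) (y - x)
        ≤ ‖gradient loss z - gradient loss x‖ * ‖y - x‖ := real_inner_le_norm _ _
      _ ≤ (L * ‖y - x‖) * ‖y - x‖ := by
          gcongr
          exact (h.2 z x).trans (by gcongr)
      _ = L * ‖y - x‖ ^ 2 := by ring
  rw [inner_sub_left] at h1
  linarith [hgrad ▸ hzeq]

theorem IsSmoothLoss.continuous_gradient {d : ℕ} {L : ℝ} {loss : Param d → ℝ}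
    (h : IsSmoothLoss L loss) (hL : 0 ≤ L) : Continuous (gradient loss) :=
  (LipschitzWith.of_dist_le_mul (K := ⟨L, hL⟩)
    (fun x y => by rw [dist_eq_norm, dist_eq_norm]; exact h.2 x y)).continuous

/-- Coordinatewise multiplication by `D`, as a linear map. -/
def diagMul {d : ℕ} (D : Fin d → ℝ) : Param d →ₗ[ℝ] Param d where
  toFun x := WithLp.toLp 2 fun i => D i * x i
  map_add' x y := by ext i; simp [mul_add]
  map_smul' c x := by ext i; simp [mul_left_comm]

theorem diagMul_apply {d : ℕ} (D : Fin d → ℝ) (x : Param d) (i : Fin d) :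
    diagMul D x i = D i * x i := rfl

theorem norm_diagMul_le {d : ℕ} {D : Fin d → ℝ} {K : ℝ} (hK : 0 ≤ K)
    (hD : ∀ i, 0 ≤ D i ∧ D i ≤ K) (x : Param d) : ‖diagMul D x‖ ≤ K * ‖x‖ := by
  refine le_of_sq_le_sq ?_ (by positivity)
  rw [mul_pow, EuclideanSpace.real_norm_sq_eq, EuclideanSpace.real_norm_sq_eq, Finset.mul_sum]
  refine Finset.sum_le_sum fun i _ => ?_
  rw [diagMul_apply, mul_pow]
  have := hD i
  gcongr
  · exact this.1
  · exact this.2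

theorem mul_norm_sq_le_inner_diagMul {d : ℕ} {D : Fin d → ℝ} {δ : ℝ}
    (hD : ∀ i, δ ≤ D i) (x : Param d) : δ * ‖x‖ ^ 2 ≤ inner ℝ x (diagMul D x) := by
  rw [EuclideanSpace.real_norm_sq_eq, Finset.mul_sum, PiLp.inner_apply]
  refine Finset.sum_le_sum fun i _ => ?_
  have : inner ℝ (x i) (diagMul D x i) = D i * x i ^ 2 := by
    rw [diagMul_apply]; simp; ring
  rw [this]
  gcongr
  exact hD i

/-! ### The one-step inequality for scalars. -/

/-- The weight of the potential on the momentum error. -/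
def potentialWeight (a B K : ℝ) : ℝ := (K ^ 2 / a + a) / (1 - B)

/-- The constant in front of the higher-order terms of the one-step inequality. -/
def errorConst (L α a B K : ℝ) : ℝ :=
  L * K ^ 2 * 2 + potentialWeight a B K * (2 * (L * K) ^ 2 * α / (1 - B))

/-- The scalar core of the one-step inequality: `r` is the gradient norm, `p` and `p'` are the norms of
the momentum error before and after the step, `μ` is the norm of the momentum. -/
theorem potential_step_scalar {L K B a α η η' r p p' μ f f' : ℝ} (hL : 0 ≤ L)
    (hB0 : 0 ≤ B) (hB : B < 1) (ha : 0 < a) (hη : 0 ≤ η) (hηα : η ≤ α) (hη' : η' ≤ η)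
    (hr : 0 ≤ r) (hp : 0 ≤ p) (hp' : 0 ≤ p') (hμ0 : 0 ≤ μ) (hμ : μ ≤ p + r)
    (hpp : p' ≤ B * p + L * K * η * μ)
    (hf : f' ≤ f - η * (a * r ^ 2 - K * r * p) + L * (η * K * μ) ^ 2) :
    f' + potentialWeight a B K * η' * p' ^ 2 + η * (a / 2) * r ^ 2 ≤
      f + potentialWeight a B K * η * p ^ 2 +
        η * ((errorConst L α a B K * η - a / 4) * (r ^ 2 + p ^ 2)) := by
  set c := potentialWeight a B K with hc
  have h1B : 0 < 1 - B := by linarith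
  have hc0 : 0 ≤ c := by rw [hc, potentialWeight]; positivity
  -- The weight is chosen so that the contraction of `p ^ 2` pays for the Young term `K ^ 2 / a` and
  -- leaves `a` to spare.
  have hcB : c * (1 - B) = K ^ 2 / a + a := by
    rw [hc, potentialWeight]; field_simp
  have hμsq : μ ^ 2 ≤ 2 * (r ^ 2 + p ^ 2) := by nlinarith [sq_nonneg (p - r)]
  have hpsq : p' ^ 2 ≤ B * p ^ 2 + (L * K * η * μ) ^ 2 / (1 - B) := by
    have h1 : p' ^ 2 ≤ (B * p + L * K * η * μ) ^ 2 := by gcongr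
    -- Convexity of the square, with `B * p + q` read as the average of `p` and `q / (1 - B)` with
    -- weights `B` and `1 - B`.
    have h2 : (B * p + L * K * η * μ) ^ 2 ≤ B * p ^ 2 + (L * K * η * μ) ^ 2 / (1 - B) := by
      generalize L * K * η * μ = q
      rw [← sub_nonneg]
      have : B * p ^ 2 + q ^ 2 / (1 - B) - (B * p + q) ^ 2 = B * ((1 - B) * p - q) ^ 2 / (1 - B) := by
        field_simp; ring
      rw [this]; positivity
    exact h1.trans h2
  have hpsq2 : p' ^ 2 ≤ B * p ^ 2 + 2 * (L * K) ^ 2 * α / (1 - B) * (η * (r ^ 2 + p ^ 2)) := by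
    refine hpsq.trans ?_
    gcongr
    calc (L * K * η * μ) ^ 2 / (1 - B) = (L * K) ^ 2 * η * η * μ ^ 2 / (1 - B) := by ring
      _ ≤ (L * K) ^ 2 * α * η * (2 * (r ^ 2 + p ^ 2)) / (1 - B) := by
        have : 0 ≤ α := hη.trans hηα
        gcongr
      _ = _ := by ring
  have hpot : c * η' * p' ^ 2 ≤
      c * η * (B * p ^ 2 + 2 * (L * K) ^ 2 * α / (1 - B) * (η * (r ^ 2 + p ^ 2))) := by
    gcongr
  have hyoung : K * r * p ≤ a / 4 * r ^ 2 + K ^ 2 / a * p ^ 2 := by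
    rw [← sub_nonneg]
    have : a / 4 * r ^ 2 + K ^ 2 / a * p ^ 2 - K * r * p = (a * r / 2 - K * p) ^ 2 / a := by
      field_simp; ring
    rw [this]; positivity
  have hyoung' := mul_le_mul_of_nonneg_left hyoung hη
  have hquad : L * (η * K * μ) ^ 2 ≤ η * (L * K ^ 2 * 2 * η * (r ^ 2 + p ^ 2)) := by
    calc L * (η * K * μ) ^ 2 = L * η ^ 2 * K ^ 2 * μ ^ 2 := by ring
      _ ≤ L * η ^ 2 * K ^ 2 * (2 * (r ^ 2 + p ^ 2)) := by gcongr
      _ = _ := by ring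
  have hcB' : c * B = c - (K ^ 2 / a + a) := by linarith
  have hexp : c * η * (B * p ^ 2 + 2 * (L * K) ^ 2 * α / (1 - B) * (η * (r ^ 2 + p ^ 2))) =
      η * (c - (K ^ 2 / a + a)) * p ^ 2 +
        η * (c * (2 * (L * K) ^ 2 * α / (1 - B)) * η * (r ^ 2 + p ^ 2)) := by
    rw [← hcB']; ring
  have herr : η * ((errorConst L α a B K * η - a / 4) * (r ^ 2 + p ^ 2)) =
      η * (L * K ^ 2 * 2 * η * (r ^ 2 + p ^ 2)) +
      η * (c * (2 * (L * K) ^ 2 * α / (1 - B)) * η * (r ^ 2 + p ^ 2)) -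
      η * (a / 4) * r ^ 2 - η * (a / 4) * p ^ 2 := by
    rw [errorConst, ← hc]; ring
  -- Of the spare `a * p ^ 2`, one quarter goes into the error term; this is the discarded rest.
  have hnn : 0 ≤ η * (3 * a / 4) * p ^ 2 := by positivity
  rw [herr]
  rw [hexp] at hpot
  linarith

/-! ### Momentum error and preconditioner along a trajectory. -/

section Dynamics

variable {d : ℕ} (loss : Param d → ℝ) (mom : Param d → Param d → ℝ) (α β₁ β₂ ε : ℝ)
  (θ₁ : Param d)

/-- The gradient at the parameters reached after `n` steps. -/
def gradAfter (n : ℕ) : Param d := gradient loss (stateAfter loss mom α β₁ β₂ ε θ₁ n).θ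

/-- The momentum coefficient used by the step that follows the first `n` steps. -/
def momAfter (n : ℕ) : ℝ :=
  mom (gradAfter loss mom α β₁ β₂ ε θ₁ n) (stateAfter loss mom α β₁ β₂ ε θ₁ n).gPrev

/-- The total weight that the first moment estimate gives to the gradients seen in `n` steps. -/
def momentWeight : ℕ → ℝ
  | 0 => 0
  | n + 1 => momAfter loss mom α β₁ β₂ ε θ₁ n * momentWeight n +
      (1 - momAfter loss mom α β₁ β₂ ε θ₁ n)

/-- The deviation of the first moment estimate from the weighted current gradient. -/
def momentError (n : ℕ) : Param d :=
  (stateAfter loss mom α β₁ β₂ ε θ₁ n).m -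
    momentWeight loss mom α β₁ β₂ ε θ₁ n • gradAfter loss mom α β₁ β₂ ε θ₁ n

/-- The diagonal preconditioner of the step that follows the first `n` steps. -/
def precond (n : ℕ) (i : Fin d) : ℝ :=
  ((1 - β₁ ^ (n + 1)) *
    (√((stateAfter loss mom α β₁ β₂ ε θ₁ (n + 1)).v i / (1 - β₂ ^ (n + 1))) + ε))⁻¹

theorem stateAfter_succ_m (n : ℕ) :
    (stateAfter loss mom α β₁ β₂ ε θ₁ (n + 1)).m =
      momAfter loss mom α β₁ β₂ ε θ₁ n • (stateAfter loss mom α β₁ β₂ ε θ₁ n).m +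
      (1 - momAfter loss mom α β₁ β₂ ε θ₁ n) • gradAfter loss mom α β₁ β₂ ε θ₁ n := rfl

theorem stateAfter_succ_v (n : ℕ) (i : Fin d) :
    (stateAfter loss mom α β₁ β₂ ε θ₁ (n + 1)).v i =
      β₂ * (stateAfter loss mom α β₁ β₂ ε θ₁ n).v i +
      (1 - β₂) * gradAfter loss mom α β₁ β₂ ε θ₁ n i ^ 2 := rfl

theorem stateAfter_succ_theta (n : ℕ) :
    (stateAfter loss mom α β₁ β₂ ε θ₁ (n + 1)).θ =
      (stateAfter loss mom α β₁ β₂ ε θ₁ n).θ - (α / √((n : ℝ) + 1)) •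
        diagMul (precond loss mom α β₁ β₂ ε θ₁ n)
          (stateAfter loss mom α β₁ β₂ ε θ₁ (n + 1)).m := by
  ext i
  have : (stateAfter loss mom α β₁ β₂ ε θ₁ (n + 1)).θ i =
      (stateAfter loss mom α β₁ β₂ ε θ₁ n).θ i - α / √((n + 1 : ℕ) : ℝ) *
        (((stateAfter loss mom α β₁ β₂ ε θ₁ (n + 1)).m i / (1 - β₁ ^ (n + 1))) /
          (√((stateAfter loss mom α β₁ β₂ ε θ₁ (n + 1)).v i / (1 - β₂ ^ (n + 1))) + ε)) := rfl
  rw [this, PiLp.sub_apply, PiLp.smul_apply, diagMul_apply, precond, smul_eq_mul, div_div,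
    div_eq_inv_mul (_ : ℝ) ((1 - β₁ ^ (n + 1)) * _)]
  push_cast
  rfl

theorem stateAfter_succ_m_eq (n : ℕ) :
    (stateAfter loss mom α β₁ β₂ ε θ₁ (n + 1)).m =
      momAfter loss mom α β₁ β₂ ε θ₁ n • momentError loss mom α β₁ β₂ ε θ₁ n +
      momentWeight loss mom α β₁ β₂ ε θ₁ (n + 1) • gradAfter loss mom α β₁ β₂ ε θ₁ n := by
  rw [stateAfter_succ_m, momentError, momentWeight]
  module

/-- Subtracting the weighted new gradient from `stateAfter_succ_m_eq` leaves only a gradient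
difference as forcing, because both terms carry the same weight. -/
theorem momentError_succ (n : ℕ) :
    momentError loss mom α β₁ β₂ ε θ₁ (n + 1) =
      momAfter loss mom α β₁ β₂ ε θ₁ n • momentError loss mom α β₁ β₂ ε θ₁ n +
      momentWeight loss mom α β₁ β₂ ε θ₁ (n + 1) •
        (gradAfter loss mom α β₁ β₂ ε θ₁ n - gradAfter loss mom α β₁ β₂ ε θ₁ (n + 1)) := by
  rw [momentError, stateAfter_succ_m_eq]
  module

variable {loss mom α β₁ β₂ ε θ₁} {B G L K δ : ℝ}

theorem momentWeight_mem (hB1 : B ≤ 1) (hmom : ∀ g g', 0 ≤ mom g g' ∧ mom g g' ≤ B) (n : ℕ) :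
    0 ≤ momentWeight loss mom α β₁ β₂ ε θ₁ n ∧ momentWeight loss mom α β₁ β₂ ε θ₁ n ≤ 1 := by
  induction n with
  | zero => simp [momentWeight]
  | succ n ih =>
    obtain ⟨h0, h1⟩ : 0 ≤ momAfter loss mom α β₁ β₂ ε θ₁ n ∧
      momAfter loss mom α β₁ β₂ ε θ₁ n ≤ B := hmom _ _
    rw [momentWeight]
    constructor
    · have := mul_nonneg h0 ih.1
      linarith
    · have := mul_le_mul_of_nonneg_left ih.2 h0
      linarith

/-- The newest gradient alone contributes at least `1 - B`. This keeps the descent rate away from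
zero. -/
theorem le_momentWeight_succ (hB1 : B ≤ 1) (hmom : ∀ g g', 0 ≤ mom g g' ∧ mom g g' ≤ B) (n : ℕ) :
    1 - B ≤ momentWeight loss mom α β₁ β₂ ε θ₁ (n + 1) := by
  obtain ⟨h0, h1⟩ : 0 ≤ momAfter loss mom α β₁ β₂ ε θ₁ n ∧
    momAfter loss mom α β₁ β₂ ε θ₁ n ≤ B := hmom _ _
  rw [momentWeight]
  have := mul_nonneg h0 (momentWeight_mem (loss := loss) (α := α) (β₁ := β₁) (β₂ := β₂)
    (ε := ε) (θ₁ := θ₁) hB1 hmom n).1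
  linarith

theorem norm_m_le (hB1 : B ≤ 1) (hmom : ∀ g g', 0 ≤ mom g g' ∧ mom g g' ≤ B)
    (hG : ∀ n, ‖gradAfter loss mom α β₁ β₂ ε θ₁ n‖ ≤ G) (n : ℕ) :
    ‖(stateAfter loss mom α β₁ β₂ ε θ₁ n).m‖ ≤ G := by
  have hG0 : 0 ≤ G := (norm_nonneg _).trans (hG 0)
  induction n with
  | zero => simpa [stateAfter] using hG0
  | succ n ih =>
    obtain ⟨h0, h1⟩ : 0 ≤ momAfter loss mom α β₁ β₂ ε θ₁ n ∧
      momAfter loss mom α β₁ β₂ ε θ₁ n ≤ B := hmom _ _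
    rw [stateAfter_succ_m]
    refine (norm_add_le _ _).trans ?_
    rw [norm_smul, norm_smul, Real.norm_of_nonneg h0, Real.norm_of_nonneg (by linarith)]
    have e1 := mul_le_mul_of_nonneg_left ih h0
    have e2 := mul_le_mul_of_nonneg_left (hG n)
      (by linarith : 0 ≤ 1 - momAfter loss mom α β₁ β₂ ε θ₁ n)
    linarith

theorem norm_momentError_le (hB1 : B ≤ 1) (hmom : ∀ g g', 0 ≤ mom g g' ∧ mom g g' ≤ B)
    (hG : ∀ n, ‖gradAfter loss mom α β₁ β₂ ε θ₁ n‖ ≤ G) (n : ℕ) :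
    ‖momentError loss mom α β₁ β₂ ε θ₁ n‖ ≤ 2 * G := by
  have hw := momentWeight_mem (loss := loss) (α := α) (β₁ := β₁) (β₂ := β₂)
    (ε := ε) (θ₁ := θ₁) hB1 hmom n
  rw [momentError]
  refine (norm_sub_le _ _).trans ?_
  rw [norm_smul, Real.norm_of_nonneg hw.1]
  have e1 := norm_m_le hB1 hmom hG n
  have e2 := mul_le_mul hw.2 (hG n) (norm_nonneg _) zero_le_one
  linarith

/-- The weights in `v` sum to `1 - β₂ ^ n`, which is exactly the factor that the bias correction
divides out. -/
theorem v_mem (hβ0 : 0 ≤ β₂) (hβ1 : β₂ ≤ 1)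
    (hG : ∀ n, ‖gradAfter loss mom α β₁ β₂ ε θ₁ n‖ ≤ G) (n : ℕ) (i : Fin d) :
    0 ≤ (stateAfter loss mom α β₁ β₂ ε θ₁ n).v i ∧
      (stateAfter loss mom α β₁ β₂ ε θ₁ n).v i ≤ (1 - β₂ ^ n) * G ^ 2 := by
  induction n with
  | zero => simp [stateAfter]
  | succ n ih =>
    rw [stateAfter_succ_v]
    have hβ : 0 ≤ 1 - β₂ := by linarith
    constructor
    · have := mul_nonneg hβ0 ih.1
      positivity
    · have hi : gradAfter loss mom α β₁ β₂ ε θ₁ n i ^ 2 ≤ G ^ 2 := by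
        rw [← sq_abs]
        gcongr
        exact (PiLp.norm_apply_le (gradAfter loss mom α β₁ β₂ ε θ₁ n) i).trans (hG n)
      have e1 := mul_le_mul_of_nonneg_left ih.2 hβ0
      have e2 := mul_le_mul_of_nonneg_left hi hβ
      rw [pow_succ β₂]
      linarith

/-- The bias-corrected root lies in `[0, G]`, and the first-moment correction `1 - β₁ ^ (n + 1)` in
`[1 - β₁bar, 1]`. -/
theorem precond_mem {β₁bar : ℝ} (hε : 0 < ε) (hβ₁ : 0 ≤ β₁) (hbar : β₁ ≤ β₁bar)
    (hbar1 : β₁bar < 1) (hβ0 : 0 ≤ β₂) (hβ1 : β₂ < 1)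
    (hG : ∀ n, ‖gradAfter loss mom α β₁ β₂ ε θ₁ n‖ ≤ G) (n : ℕ) (i : Fin d) :
    (G + ε)⁻¹ ≤ precond loss mom α β₁ β₂ ε θ₁ n i ∧
      precond loss mom α β₁ β₂ ε θ₁ n i ≤ ((1 - β₁bar) * ε)⁻¹ := by
  have hG0 : 0 ≤ G := (norm_nonneg _).trans (hG 0)
  have hv := v_mem hβ0 hβ1.le hG (n + 1) i
  have hpow : β₁ ^ (n + 1) ≤ β₁bar :=
    (pow_le_of_le_one hβ₁ (hbar.trans hbar1.le) n.succ_ne_zero).trans hbar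
  have hpow0 : 0 ≤ β₁ ^ (n + 1) := by positivity
  have hβ2 : 0 < 1 - β₂ ^ (n + 1) := sub_pos.2 (pow_lt_one₀ hβ0 hβ1 n.succ_ne_zero)
  have hs : √((stateAfter loss mom α β₁ β₂ ε θ₁ (n + 1)).v i / (1 - β₂ ^ (n + 1))) ≤ G := by
    rw [Real.sqrt_le_left hG0, div_le_iff₀ hβ2]
    linarith
  have hs0 := Real.sqrt_nonneg
    ((stateAfter loss mom α β₁ β₂ ε θ₁ (n + 1)).v i / (1 - β₂ ^ (n + 1)))
  rw [precond]
  have h1 : 0 < 1 - β₁bar := by linarith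
  constructor
  · apply inv_anti₀
    · exact mul_pos (by linarith) (by linarith)
    · calc _ ≤ 1 * (G + ε) := by gcongr; linarith
        _ = G + ε := one_mul _
  · apply inv_anti₀ (by positivity)
    gcongr
    · linarith
    · exact le_add_of_nonneg_left hs0

/-- One step decreases the potential by a multiple of the squared gradient norm, up to an error that
is of higher order in the step size. -/
theorem potential_step (hL : 0 ≤ L) (hloss : IsSmoothLoss L loss) (hα : 0 ≤ α) (hK : 0 ≤ K)
    (hδ : 0 < δ) (hB0 : 0 ≤ B) (hB1 : B < 1) (hmom : ∀ g g', 0 ≤ mom g g' ∧ mom g g' ≤ B)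
    (n : ℕ) (hD : ∀ i, δ ≤ precond loss mom α β₁ β₂ ε θ₁ n i ∧
      precond loss mom α β₁ β₂ ε θ₁ n i ≤ K) :
    loss (stateAfter loss mom α β₁ β₂ ε θ₁ (n + 1)).θ +
        potentialWeight ((1 - B) * δ) B K * (α / √((n + 1 : ℕ) + 1 : ℝ)) *
          ‖momentError loss mom α β₁ β₂ ε θ₁ (n + 1)‖ ^ 2 +
        α / √((n : ℝ) + 1) * ((1 - B) * δ / 2) * ‖gradAfter loss mom α β₁ β₂ ε θ₁ n‖ ^ 2 ≤
      loss (stateAfter loss mom α β₁ β₂ ε θ₁ n).θ +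
        potentialWeight ((1 - B) * δ) B K * (α / √((n : ℝ) + 1)) *
          ‖momentError loss mom α β₁ β₂ ε θ₁ n‖ ^ 2 +
        α / √((n : ℝ) + 1) *
          ((errorConst L α ((1 - B) * δ) B K * (α / √((n : ℝ) + 1)) - (1 - B) * δ / 4) *
            (‖gradAfter loss mom α β₁ β₂ ε θ₁ n‖ ^ 2 +
              ‖momentError loss mom α β₁ β₂ ε θ₁ n‖ ^ 2)) := by
  obtain ⟨hb0, hb1⟩ : 0 ≤ momAfter loss mom α β₁ β₂ ε θ₁ n ∧
    momAfter loss mom α β₁ β₂ ε θ₁ n ≤ B := hmom _ _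
  obtain ⟨hw0, hw1⟩ := momentWeight_mem (loss := loss) (α := α) (β₁ := β₁) (β₂ := β₂)
    (ε := ε) (θ₁ := θ₁) hB1.le hmom (n + 1)
  have hw := le_momentWeight_succ (loss := loss) (α := α) (β₁ := β₁) (β₂ := β₂)
    (ε := ε) (θ₁ := θ₁) hB1.le hmom n
  have hm := stateAfter_succ_m_eq loss mom α β₁ β₂ ε θ₁ n
  have he := momentError_succ loss mom α β₁ β₂ ε θ₁ n
  have hx := stateAfter_succ_theta loss mom α β₁ β₂ ε θ₁ n
  have hdesc := hloss.le_add_inner hL (stateAfter loss mom α β₁ β₂ ε θ₁ n).θ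
    (stateAfter loss mom α β₁ β₂ ε θ₁ (n + 1)).θ
  have hlip := hloss.2 (stateAfter loss mom α β₁ β₂ ε θ₁ n).θ
    (stateAfter loss mom α β₁ β₂ ε θ₁ (n + 1)).θ
  have hη0 : 0 ≤ α / √((n : ℝ) + 1) := by positivity
  have hsqrt : 1 ≤ √((n : ℝ) + 1) := by
    rw [Real.one_le_sqrt]; linarith [Nat.cast_nonneg (α := ℝ) n]
  have hηα : α / √((n : ℝ) + 1) ≤ α := div_le_self hα hsqrt
  -- Step sizes decrease, so the weight of the momentum error in the potential does not grow.
  have hη' : α / √((n + 1 : ℕ) + 1 : ℝ) ≤ α / √((n : ℝ) + 1) := by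
    gcongr
    linarith
  change loss _ ≤ _ + inner ℝ (gradAfter loss mom α β₁ β₂ ε θ₁ n) _ + _ at hdesc
  change ‖gradAfter loss mom α β₁ β₂ ε θ₁ n - gradAfter loss mom α β₁ β₂ ε θ₁ (n + 1)‖ ≤ _
    at hlip
  set D := precond loss mom α β₁ β₂ ε θ₁ n
  set g := gradAfter loss mom α β₁ β₂ ε θ₁ n
  set e := momentError loss mom α β₁ β₂ ε θ₁ n
  set b := momAfter loss mom α β₁ β₂ ε θ₁ n
  set w := momentWeight loss mom α β₁ β₂ ε θ₁ (n + 1)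
  set x := (stateAfter loss mom α β₁ β₂ ε θ₁ n).θ
  set m := (stateAfter loss mom α β₁ β₂ ε θ₁ (n + 1)).m
  set η := α / √((n : ℝ) + 1)
  have hD0 : ∀ i, 0 ≤ D i ∧ D i ≤ K := fun i => ⟨hδ.le.trans (hD i).1, (hD i).2⟩
  have hstep : (stateAfter loss mom α β₁ β₂ ε θ₁ (n + 1)).θ - x = -(η • diagMul D m) := by
    rw [hx]; abel
  have hstep' : ‖(stateAfter loss mom α β₁ β₂ ε θ₁ (n + 1)).θ - x‖ ≤ η * K * ‖m‖ := by
    rw [hstep, norm_neg, norm_smul, Real.norm_of_nonneg hη0, mul_assoc]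
    gcongr
    exact norm_diagMul_le hK hD0 m
  have hmle : ‖m‖ ≤ ‖e‖ + ‖g‖ := by
    rw [hm]
    refine (norm_add_le _ _).trans ?_
    rw [norm_smul, norm_smul, Real.norm_of_nonneg hb0, Real.norm_of_nonneg hw0]
    exact add_le_add (mul_le_of_le_one_left (norm_nonneg _) (hb1.trans hB1.le))
      (mul_le_of_le_one_left (norm_nonneg _) hw1)
  have hinner : (1 - B) * δ * ‖g‖ ^ 2 - K * ‖g‖ * ‖e‖ ≤ inner ℝ g (diagMul D m) := by
    rw [hm, map_add, map_smul, map_smul, inner_add_right, inner_smul_right, inner_smul_right]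
    have h1 : (1 - B) * (δ * ‖g‖ ^ 2) ≤ w * inner ℝ g (diagMul D g) := by
      gcongr
      exact mul_norm_sq_le_inner_diagMul (fun i => (hD i).1) g
    have h2 : |b * inner ℝ g (diagMul D e)| ≤ 1 * (‖g‖ * (K * ‖e‖)) := by
      rw [abs_mul, abs_of_nonneg hb0]
      gcongr
      · exact hb1.trans hB1.le
      · exact (abs_real_inner_le_norm _ _).trans (by gcongr; exact norm_diagMul_le hK hD0 e)
    have h3 := neg_le_of_abs_le h2
    linarith
  refine potential_step_scalar hL hB0 hB1 (mul_pos (sub_pos.2 hB1) hδ)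
    hη0 hηα hη' (norm_nonneg g) (norm_nonneg e) (norm_nonneg _) (norm_nonneg m) hmle ?_ ?_
  · rw [he]
    refine (norm_add_le _ _).trans ?_
    rw [norm_smul, norm_smul, Real.norm_of_nonneg hb0, Real.norm_of_nonneg hw0]
    refine add_le_add (by gcongr) ?_
    refine (mul_le_of_le_one_left (norm_nonneg _) hw1).trans (hlip.trans ?_)
    rw [norm_sub_rev]
    calc L * ‖(stateAfter loss mom α β₁ β₂ ε θ₁ (n + 1)).θ - x‖ ≤ L * (η * K * ‖m‖) := by gcongr
      _ = L * K * η * ‖m‖ := by ring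
  · refine hdesc.trans ?_
    rw [sub_eq_add_neg (loss x)]
    gcongr
    rw [hstep, inner_neg_right, inner_smul_right]
    have := mul_le_mul_of_nonneg_left hinner hη0
    linarith

end Dynamics

/-! ### Telescoping and the pathwise bound. -/

/-- A bound for the total of the errors in the one-step inequalities. -/
def totalError (L G α a B K : ℝ) : ℝ :=
  ⌈(4 * α * errorConst L α a B K / a) ^ 2⌉₊ * (α * (errorConst L α a B K * α * (5 * G ^ 2)))

theorem errorConst_nonneg {L α a B K : ℝ} (hL : 0 ≤ L) (hα : 0 ≤ α) (ha : 0 ≤ a) (hB : B < 1) :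
    0 ≤ errorConst L α a B K := by
  have : 0 < 1 - B := by linarith
  rw [errorConst, potentialWeight]
  positivity

section Dynamics

variable {d : ℕ} {loss : Param d → ℝ} {mom : Param d → Param d → ℝ} {α β₁ β₂ ε : ℝ}
  {θ₁ : Param d} {B G L K δ lossInf : ℝ}

theorem sum_step_mul_norm_grad_sq_le (hL : 0 ≤ L) (hloss : IsSmoothLoss L loss)
    (hinf : ∀ θ, lossInf ≤ loss θ) (hα : 0 ≤ α) (hK : 0 ≤ K)
    (hδ : 0 < δ) (hB0 : 0 ≤ B) (hB1 : B < 1) (hmom : ∀ g g', 0 ≤ mom g g' ∧ mom g g' ≤ B)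
    (hG : ∀ n, ‖gradAfter loss mom α β₁ β₂ ε θ₁ n‖ ≤ G)
    (hD : ∀ n i, δ ≤ precond loss mom α β₁ β₂ ε θ₁ n i ∧
      precond loss mom α β₁ β₂ ε θ₁ n i ≤ K) (T : ℕ) :
    ∑ n ∈ Finset.range T, α / √((n : ℝ) + 1) * ((1 - B) * δ / 2) *
        ‖gradAfter loss mom α β₁ β₂ ε θ₁ n‖ ^ 2 ≤
      loss θ₁ - lossInf + totalError L G α ((1 - B) * δ) B K := by
  have h1B : 0 < 1 - B := by linarith
  set a := (1 - B) * δ with ha_def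
  have ha : 0 < a := by positivity
  have hM : 0 ≤ errorConst L α a B K := errorConst_nonneg hL hα ha.le hB1
  have hc : 0 ≤ potentialWeight a B K := by rw [potentialWeight]; positivity
  have hG0 : 0 ≤ G := (norm_nonneg _).trans (hG 0)
  set M := errorConst L α a B K with hM_def
  -- From step `N` on, `M * η ≤ a / 4`, so the error term is nonpositive.
  set N := ⌈(4 * α * M / a) ^ 2⌉₊ with hN
  set R := α * (M * α * (5 * G ^ 2)) with hR
  have hR0 : 0 ≤ R := by positivity
  have herr : ∀ n : ℕ, α / √((n : ℝ) + 1) * ((M * (α / √((n : ℝ) + 1)) - a / 4) *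
      (‖gradAfter loss mom α β₁ β₂ ε θ₁ n‖ ^ 2 + ‖momentError loss mom α β₁ β₂ ε θ₁ n‖ ^ 2)) ≤
      if n < N then R else 0 := by
    intro n
    have hsqrt : 1 ≤ √((n : ℝ) + 1) := by
      rw [Real.one_le_sqrt]; linarith [Nat.cast_nonneg (α := ℝ) n]
    have hη0 : 0 ≤ α / √((n : ℝ) + 1) := by positivity
    split_ifs with h
    · have hηα : α / √((n : ℝ) + 1) ≤ α := div_le_self hα hsqrt
      -- The 5 is 1 + 4, from `‖g‖ ≤ G` and `‖e‖ ≤ 2 * G`.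
      have hsum : ‖gradAfter loss mom α β₁ β₂ ε θ₁ n‖ ^ 2 +
          ‖momentError loss mom α β₁ β₂ ε θ₁ n‖ ^ 2 ≤ 5 * G ^ 2 := by
        have e1 := pow_le_pow_left₀ (norm_nonneg _) (hG n) 2
        have e2 := pow_le_pow_left₀ (norm_nonneg _) (norm_momentError_le hB1.le hmom hG n) 2
        linarith
      rw [hR]
      calc _ ≤ α / √((n : ℝ) + 1) * (M * (α / √((n : ℝ) + 1)) *
            (‖gradAfter loss mom α β₁ β₂ ε θ₁ n‖ ^ 2 +
              ‖momentError loss mom α β₁ β₂ ε θ₁ n‖ ^ 2)) := by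
            gcongr; linarith
        _ ≤ _ := by gcongr
    · have hn : (4 * α * M / a) ^ 2 ≤ (n : ℝ) + 1 :=
        (Nat.ceil_le.1 (not_lt.1 h)).trans (by linarith)
      have hs : 4 * α * M / a ≤ √((n : ℝ) + 1) := Real.le_sqrt_of_sq_le hn
      rw [div_le_iff₀ ha] at hs
      have hs' : M * (α / √((n : ℝ) + 1)) ≤ a / 4 := by
        rw [← mul_div_assoc, div_le_iff₀ (by positivity)]
        linarith
      exact mul_nonpos_of_nonneg_of_nonpos hη0
        (mul_nonpos_of_nonpos_of_nonneg (by linarith) (by positivity))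
  have key : ∀ T : ℕ, loss (stateAfter loss mom α β₁ β₂ ε θ₁ T).θ +
      potentialWeight a B K * (α / √((T : ℝ) + 1)) *
        ‖momentError loss mom α β₁ β₂ ε θ₁ T‖ ^ 2 +
      ∑ n ∈ Finset.range T, α / √((n : ℝ) + 1) * (a / 2) *
        ‖gradAfter loss mom α β₁ β₂ ε θ₁ n‖ ^ 2 ≤
      loss θ₁ + ∑ n ∈ Finset.range T, if n < N then R else 0 := by
    intro T
    induction T with
    -- The momentum error vanishes initially, so the potential starts at the loss itself.
    | zero => simp [stateAfter, momentError, momentWeight]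
    | succ T ih =>
      rw [Finset.sum_range_succ, Finset.sum_range_succ]
      have h1 := potential_step hL hloss hα hK hδ hB0 hB1 hmom T (hD T)
      have h2 := herr T
      linarith
  have hsumR : (∑ n ∈ Finset.range T, if n < N then R else 0) ≤ N * R := by
    rw [← Finset.sum_filter, Finset.sum_const, nsmul_eq_mul]
    gcongr
    exact (Finset.card_le_card (t := Finset.range N) fun n hn => by simp_all).trans_eq
      (Finset.card_range N)
  have hfin := key T
  have hpos : 0 ≤ potentialWeight a B K * (α / √((T : ℝ) + 1)) *
        ‖momentError loss mom α β₁ β₂ ε θ₁ T‖ ^ 2 := by positivity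
  have := hinf (stateAfter loss mom α β₁ β₂ ε θ₁ T).θ
  rw [totalError]
  linarith

/-- Each step size before time `T` is at least `α / √T`, so the weights can be removed at the price
of `√T`. -/
theorem sum_norm_grad_sq_le (hL : 0 ≤ L) (hloss : IsSmoothLoss L loss)
    (hinf : ∀ θ, lossInf ≤ loss θ) (hα : 0 < α) (hK : 0 ≤ K)
    (hδ : 0 < δ) (hB0 : 0 ≤ B) (hB1 : B < 1) (hmom : ∀ g g', 0 ≤ mom g g' ∧ mom g g' ≤ B)
    (hG : ∀ n, ‖gradAfter loss mom α β₁ β₂ ε θ₁ n‖ ≤ G)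
    (hD : ∀ n i, δ ≤ precond loss mom α β₁ β₂ ε θ₁ n i ∧
      precond loss mom α β₁ β₂ ε θ₁ n i ≤ K) (T : ℕ) :
    ∑ n ∈ Finset.range T, ‖gradAfter loss mom α β₁ β₂ ε θ₁ n‖ ^ 2 ≤
      √T * (2 / (α * ((1 - B) * δ)) *
        (loss θ₁ - lossInf + totalError L G α ((1 - B) * δ) B K)) := by
  have h1B : 0 < 1 - B := by linarith
  refine le_trans ?_ (mul_le_mul_of_nonneg_left (mul_le_mul_of_nonneg_left
    (sum_step_mul_norm_grad_sq_le hL hloss hinf hα.le hK hδ hB0 hB1 hmom hG hD T)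
    (by positivity)) (Real.sqrt_nonneg _))
  rw [Finset.mul_sum, Finset.mul_sum]
  refine Finset.sum_le_sum fun n hn => ?_
  have hnT : (n : ℝ) + 1 ≤ T := by exact_mod_cast Finset.mem_range.1 hn
  have hs : √((n : ℝ) + 1) ≤ √T := Real.sqrt_le_sqrt hnT
  have hs0 : 0 < √((n : ℝ) + 1) := Real.sqrt_pos.2 (by positivity)
  have : √T * (2 / (α * ((1 - B) * δ)) * (α / √((n : ℝ) + 1) * ((1 - B) * δ / 2) *
      ‖gradAfter loss mom α β₁ β₂ ε θ₁ n‖ ^ 2)) =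
      √T / √((n : ℝ) + 1) * ‖gradAfter loss mom α β₁ β₂ ε θ₁ n‖ ^ 2 := by
    field_simp
  rw [this]
  exact le_mul_of_one_le_left (by positivity) ((one_le_div hs0).2 hs)

/-! ### Measurability and expectations. -/

theorem measurable_stateAfter {Ω : Type*} [MeasurableSpace Ω] {θ₁ : Ω → Param d}
    (hgrad : Measurable (gradient loss))
    (hmom : Measurable fun p : Param d × Param d => mom p.1 p.2) (hθ : Measurable θ₁) (n : ℕ) :
    Measurable (fun ω => (stateAfter loss mom α β₁ β₂ ε (θ₁ ω) n).θ) ∧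
    Measurable (fun ω => (stateAfter loss mom α β₁ β₂ ε (θ₁ ω) n).m) ∧
    Measurable (fun ω => (stateAfter loss mom α β₁ β₂ ε (θ₁ ω) n).v) ∧
    Measurable (fun ω => (stateAfter loss mom α β₁ β₂ ε (θ₁ ω) n).gPrev) := by
  induction n with
  | zero => exact ⟨hθ, measurable_const, measurable_const, measurable_const⟩
  | succ n ih =>
    obtain ⟨h1, h2, h3, h4⟩ := ih
    have hg : Measurable fun ω => gradAfter loss mom α β₁ β₂ ε (θ₁ ω) n := hgrad.comp h1
    have hb : Measurable fun ω => momAfter loss mom α β₁ β₂ ε (θ₁ ω) n :=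
      hmom.comp (hg.prodMk h4)
    have hm : Measurable fun ω => (stateAfter loss mom α β₁ β₂ ε (θ₁ ω) (n + 1)).m := by
      simp only [stateAfter_succ_m]
      exact (hb.smul h2).add ((measurable_const.sub hb).smul hg)
    have hv : Measurable fun ω => (stateAfter loss mom α β₁ β₂ ε (θ₁ ω) (n + 1)).v := by
      refine measurable_pi_lambda _ fun i => ?_
      simp only [stateAfter_succ_v]
      fun_prop
    have hD : Measurable fun ω => diagMul (precond loss mom α β₁ β₂ ε (θ₁ ω) n)
        (stateAfter loss mom α β₁ β₂ ε (θ₁ ω) (n + 1)).m := by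
      refine (PiLp.continuous_toLp 2 _).measurable.comp (measurable_pi_lambda _ fun i => ?_)
      simp only [precond]
      fun_prop
    refine ⟨?_, hm, hv, hg⟩
    simp only [stateAfter_succ_theta]
    exact h1.sub (hD.fun_const_smul _)

/-- The convergence rate for every momentum rule with coefficients in `[0, B]`. -/
theorem hasRate_stateAfter {Ω : Type*} [MeasurableSpace Ω] {P : Measure Ω}
    [IsProbabilityMeasure P] {θ₁ : Ω → Param d} {β₁bar Δ : ℝ} (hL : 0 ≤ L) (hα : 0 < α)
    (hε : 0 < ε) (hβ₁ : 0 ≤ β₁) (hbar : β₁ ≤ β₁bar) (hbar1 : β₁bar < 1) (hβ0 : 0 ≤ β₂)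
    (hβ1 : β₂ < 1) (hB0 : 0 ≤ B) (hB1 : B < 1) (hloss : IsSmoothLoss L loss)
    (hinf : ∀ θ, lossInf ≤ loss θ) (hmom : ∀ g g', 0 ≤ mom g g' ∧ mom g g' ≤ B)
    (hmom_meas : Measurable fun p : Param d × Param d => mom p.1 p.2)
    (hθ : Measurable θ₁) (hint : Integrable (fun ω => loss (θ₁ ω)) P)
    (hΔ : (∫ ω, loss (θ₁ ω) ∂P) - lossInf ≤ Δ)
    (hbdd : GradientsBounded P loss
      (fun t ω => (stateAfter loss mom α β₁ β₂ ε (θ₁ ω) (t - 1)).θ) G) :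
    HasRate P loss (fun t ω => (stateAfter loss mom α β₁ β₂ ε (θ₁ ω) (t - 1)).θ)
      (2 / (α * ((1 - B) * (G + ε)⁻¹)) *
        (Δ + totalError L G α ((1 - B) * (G + ε)⁻¹) B ((1 - β₁bar) * ε)⁻¹)) := by
  have hG : ∀ᵐ ω ∂P, ∀ n, ‖gradAfter loss mom α β₁ β₂ ε (θ₁ ω) n‖ ≤ G := by
    filter_upwards [hbdd] with ω hω n using hω (n + 1) (by omega)
  -- A probability measure has a good trajectory, which forces `0 ≤ G`.
  obtain ⟨ω₀, hω₀⟩ := hG.exists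
  have hG0 : 0 ≤ G := (norm_nonneg _).trans (hω₀ 0)
  have h1B : 0 < 1 - B := by linarith
  have h1β : 0 < 1 - β₁bar := by linarith
  have hsq_int : ∀ n, Integrable (fun ω => ‖gradAfter loss mom α β₁ β₂ ε (θ₁ ω) n‖ ^ 2) P := by
    intro n
    have hmeas : Measurable fun ω => gradAfter loss mom α β₁ β₂ ε (θ₁ ω) n :=
      (hloss.continuous_gradient hL).measurable.comp
        (measurable_stateAfter (hloss.continuous_gradient hL).measurable hmom_meas hθ n).1
    refine Integrable.of_bound (hmeas.norm.pow_const 2).aestronglyMeasurable (G ^ 2) ?_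
    filter_upwards [hG] with ω hω
    rw [Real.norm_of_nonneg (by positivity)]
    gcongr
    exact hω n
  refine ⟨fun t _ => hsq_int (t - 1), fun T hT => ?_⟩
  set c := 2 / (α * ((1 - B) * (G + ε)⁻¹)) with hc
  have hc0 : 0 ≤ c := by positivity
  set E := totalError L G α ((1 - B) * (G + ε)⁻¹) B ((1 - β₁bar) * ε)⁻¹
  have hsum : ∑ t ∈ Finset.Icc 1 T,
      ∫ ω, ‖gradient loss (stateAfter loss mom α β₁ β₂ ε (θ₁ ω) (t - 1)).θ‖ ^ 2 ∂P =
      ∫ ω, ∑ n ∈ Finset.range T, ‖gradAfter loss mom α β₁ β₂ ε (θ₁ ω) n‖ ^ 2 ∂P := by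
    rw [integral_finsetSum _ fun n _ => hsq_int n]
    refine Finset.sum_nbij' (· - 1) (· + 1) ?_ ?_ ?_ ?_ fun _ _ => rfl
    all_goals
      intro n hn
      simp only [Finset.mem_Icc, Finset.mem_range] at hn ⊢
      omega
  have hint' : Integrable (fun ω => loss (θ₁ ω) - lossInf) P := hint.sub (integrable_const _)
  have hle : ∫ ω, ∑ n ∈ Finset.range T, ‖gradAfter loss mom α β₁ β₂ ε (θ₁ ω) n‖ ^ 2 ∂P ≤
      √T * (c * (Δ + E)) := by
    calc _ ≤ ∫ ω, √T * (c * (loss (θ₁ ω) - lossInf + E)) ∂P := by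
          refine integral_mono_ae (integrable_finsetSum _ fun n _ => hsq_int n)
            (((hint'.add (integrable_const _)).const_mul _).const_mul _)
            ?_
          filter_upwards [hG] with ω hω
          exact sum_norm_grad_sq_le hL hloss hinf hα (by positivity) (by positivity) hB0 hB1 hmom
            hω (precond_mem hε hβ₁ hbar hbar1 hβ0 hβ1 hω) T
      _ = √T * (c * ((∫ ω, loss (θ₁ ω) ∂P) - lossInf + E)) := by
          rw [integral_const_mul, integral_const_mul,
            integral_add hint' (integrable_const _),
            integral_sub hint (integrable_const _)]
          simp
      _ ≤ _ := by gcongr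
  have hT0 : (0 : ℝ) < T := by exact_mod_cast hT
  rw [hsum]
  calc _ ≤ 1 / (T : ℝ) * (√T * (c * (Δ + E))) := by gcongr
    _ = c * (Δ + E) / √(T : ℝ) := by
      have hs : 0 < √(T : ℝ) := Real.sqrt_pos.2 hT0
      have hss := Real.mul_self_sqrt hT0.le
      rw [eq_div_iff hs.ne', one_div, inv_mul_eq_div, div_mul_eq_mul_div, div_eq_iff hT0.ne']
      linear_combination c * (Δ + E) * hss

end Dynamics

theorem measurable_adaptiveMomentum {d : ℕ} (β₁ β₁min β₁max lam ε : ℝ) :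
    Measurable fun p : Param d × Param d =>
      adaptiveMomentum β₁ β₁min β₁max lam ε p.1 p.2 := by
  unfold adaptiveMomentum clip consecutiveCosine
  fun_prop

theorem clip_mem {x lo hi : ℝ} (h : lo ≤ hi) : lo ≤ clip x lo hi ∧ clip x lo hi ≤ hi :=
  ⟨le_max_left _ _, max_le h (min_le_right _ _)⟩

end GONO

end

theorem theorem2 (L G α β₁bar β₁max β₂ ε Δ : ℝ)
    (hL : 0 ≤ L) (hα : 0 < α) (hε : 0 < ε) (hbar : β₁bar < 1)
    (hmaxβ₂ : β₁max < √β₂) (hβ₂ : √β₂ < 1) :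
    ∃ C : ℝ, ∀ (d : ℕ) (loss : GONO.Param d → ℝ) (lossInf : ℝ)
      (β₁ β₁min lam : ℝ)
      {Ω : Type*} [MeasurableSpace Ω] (P : Measure Ω) [IsProbabilityMeasure P]
      (θ₁ : Ω → GONO.Param d),
      GONO.IsSmoothLoss L loss →
      (∀ θ, lossInf ≤ loss θ) →
      0 ≤ β₁ → β₁ ≤ β₁bar → 0 < β₁min → β₁min ≤ β₁max → 0 ≤ lam →
      Measurable θ₁ →
      Integrable (fun ω => loss (θ₁ ω)) P →
      (∫ ω, loss (θ₁ ω) ∂P) - lossInf ≤ Δ →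
      (GONO.GradientsBounded P loss
          (fun t ω => GONO.gonoIterate loss α β₁ β₁min β₁max lam β₂ ε (θ₁ ω) t) G →
        GONO.HasRate P loss
          (fun t ω => GONO.gonoIterate loss α β₁ β₁min β₁max lam β₂ ε (θ₁ ω) t) C) ∧
      (β₁min ≤ β₁ → β₁ ≤ β₁max →
        GONO.GradientsBounded P loss
          (fun t ω => GONO.adamIterate loss α β₁ β₂ ε (θ₁ ω) t) G →
        GONO.HasRate P loss
          (fun t ω => GONO.adamIterate loss α β₁ β₂ ε (θ₁ ω) t) C) := by
  -- The pathwise constant with `B = β₁max`, `δ = (G + ε)⁻¹`, `K = ((1 - β₁bar) * ε)⁻¹`, and the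
  -- initial gap replaced by `Δ`.
  refine ⟨2 / (α * ((1 - β₁max) * (G + ε)⁻¹)) *
    (Δ + GONO.totalError L G α ((1 - β₁max) * (G + ε)⁻¹) β₁max ((1 - β₁bar) * ε)⁻¹), ?_⟩
  intro d loss lossInf β₁ β₁min lam Ω _ P _ θ₁ hloss hinf hβ₁ hβ₁bar hmin hminmax _ hθ hint hΔ
  have hmax0 : 0 ≤ β₁max := hmin.le.trans hminmax
  have hβ0 : 0 ≤ β₂ := (Real.sqrt_pos.1 (hmax0.trans_lt hmaxβ₂)).le
  have hβ1 : β₂ < 1 := by rwa [Real.sqrt_lt' one_pos, one_pow] at hβ₂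
  have hmax1 : β₁max < 1 := hmaxβ₂.trans hβ₂
  refine ⟨fun hbdd => ?_, fun _ hβ₁max hbdd => ?_⟩
  · exact GONO.hasRate_stateAfter hL hα hε hβ₁ hβ₁bar hbar hβ0 hβ1 hmax0 hmax1 hloss hinf
      (fun g g' => ⟨hmin.le.trans (GONO.clip_mem hminmax).1, (GONO.clip_mem hminmax).2⟩)
      (GONO.measurable_adaptiveMomentum β₁ β₁min β₁max lam ε) hθ hint hΔ hbdd
  · exact GONO.hasRate_stateAfter hL hα hε hβ₁ hβ₁bar hbar hβ0 hβ1 hmax0 hmax1 hloss hinf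
      (fun _ _ => ⟨hβ₁, hβ₁max⟩) measurable_const hθ hint hΔ hbdd
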